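/- All graphs are finite, simple and undirected; $\Delta(G)$ denotes the maximum degree of $G$ (with $\Delta(G)=0$ if $G$ has no vertices). A graph $G$ on $n$ vertices is *$t$-degenerate* if its vertices can be ordered $v_1,\dots,v_n$ so that each $v_i$ has at most $t$ neighbors $v_j$ with $j>i$. A *linear forest* is a forest each of whose connected components is a path (possibly a single vertex). A *$k$-linear coloring* of $G$ is a map $c:E(G)\to\{1,\dots,k\}$ such that each color class $c^{-1}(i)$ is the edge set of a linear forest, and the *linear arboricity* $\chi'_l(G)$ is the least $k$ for which $G$ has a $k$-linear coloring. **Theorem.** 1. Let $k$ be a positive integer and let $G$ be a 3-degenerate graph with $\Delta(G)\le 2k-1$. Then $G$ has a $k$-linear coloring, i.e. $\chi'_l(G)\le k$. 2. Consequently the linear arboricity conjecture holds for 3-degenerate graphs: every 3-degenerate graph $G$ satisfies $\chi'_l(G)\le\left\lceil\frac{\Delta(G)+1}{2}\right\rceil$. 3. In particular, every graph $G$ of treewidth at most 3 satisfies $\chi'_l(G)\le\left\lceil\frac{\Delta(G)+1}{2}\right\rceil$. -/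

import Mathlib

namespace SimpleGraph

/-- An enumeration `e 0, e 1, …, e (n - 1)` of all the vertices of `G` is a `t`-degeneracy
ordering if every vertex has at most `t` neighbors that come after it. -/
def IsDegeneracyOrdering {V : Type*} [Fintype V] (G : SimpleGraph V) (t : ℕ)
    (e : Fin (Fintype.card V) ≃ V) : Prop :=
  ∀ i, {j | i < j ∧ G.Adj (e i) (e j)}.ncard ≤ t

/-- A finite graph is `t`-degenerate if it has a `t`-degeneracy ordering. -/
def IsDegenerate {V : Type*} [Fintype V] (G : SimpleGraph V) (t : ℕ) : Prop :=
  ∃ e : Fin (Fintype.card V) ≃ V, G.IsDegeneracyOrdering t e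

/-- A linear forest is a forest each of whose connected components is a path: the subgraph induced
on the component is the graph traced by some walk without repeated vertices. (A single vertex is a
path of length `0`.) -/
def IsLinearForest {V : Type*} (H : SimpleGraph V) : Prop :=
  H.IsAcyclic ∧ ∀ c : H.ConnectedComponent, ∃ (u v : V) (p : H.Walk u v),
    p.IsPath ∧ (⊤ : H.Subgraph).induce c.supp = p.toSubgraph

/-- An edge coloring is linear if each color class (as a spanning subgraph) is a linear forest.
A `k`-linear coloring is a linear `c : G.EdgeLabeling (Fin k)`. -/
def EdgeLabeling.IsLinear {V K : Type*} {G : SimpleGraph V} (c : G.EdgeLabeling K) : Prop :=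
  ∀ i : K, (c.labelGraph i).IsLinearForest

/-- The linear arboricity of `G`: the least `k` for which `G` has a `k`-linear coloring. It is
valued in `ℕ∞` so that it would be `⊤` if there were no such `k`. -/
noncomputable def linearArboricity {V : Type*} (G : SimpleGraph V) : ℕ∞ :=
  ⨅ k ∈ {k : ℕ | ∃ c : G.EdgeLabeling (Fin k), c.IsLinear}, (k : ℕ∞)

/-- A tree decomposition of `G`, indexed by the nodes of a finite tree. -/
structure TreeDecomposition {V : Type*} (G : SimpleGraph V) where
  /-- the nodes of the tree -/
  Node : Type
  /-- there are finitely many nodes -/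
  fintypeNode : Fintype Node
  /-- the tree -/
  tree : SimpleGraph Node
  isTree : tree.IsTree
  /-- the set of vertices of `G` attached to a node -/
  bag : Node → Finset V
  /-- every vertex lies in a bag -/
  exists_mem_bag : ∀ v : V, ∃ t, v ∈ bag t
  /-- both ends of every edge lie in a common bag -/
  exists_adj_mem_bag : ∀ u v : V, G.Adj u v → ∃ t, u ∈ bag t ∧ v ∈ bag t
  /-- the nodes whose bag contains a given vertex induce a subtree -/
  preconnected : ∀ v : V, (tree.induce {t | v ∈ bag t}).Preconnected

/-- The width of a tree decomposition: the largest size of a bag, minus one (`0` in the case that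
all bags are empty, which occurs only for the graph without vertices). -/
def TreeDecomposition.width {V : Type*} {G : SimpleGraph V} (D : G.TreeDecomposition) : ℕ :=
  letI := D.fintypeNode
  Finset.univ.sup (fun t => (D.bag t).card) - 1

/-- The treewidth of `G`: the least width of a tree decomposition of `G`. -/
noncomputable def treewidth {V : Type*} (G : SimpleGraph V) : ℕ∞ :=
  ⨅ D : G.TreeDecomposition, (D.width : ℕ∞)

end SimpleGraph

/-!
A graph is `3`-degenerate exactly when every nonempty set of vertices contains a vertex with at most
three neighbors in the set (`IsHereditarilySparse`). A linear coloring with `k` colors is built, for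
all such graphs with maximum degree less than `2 * k`, by induction on the number of edges
(`exists_isLinearColoring`). Colorings are functions on unordered pairs of vertices, so that the
vertex set stays fixed throughout.

Let `v` have degree at most `3`, and color the graph without `v`. A neighbor of `v` then has degree
at most `2 * k - 2`, so it misses one color entirely or has two colors that occur at most once. As a
path has only two ends (`IsPathUnion.not_reachable_three`), the edges at `v` can be colored, except
when `v` has degree `3` and all its neighbors `x`, `y`, `z` miss one and the same color `a` while
all other colors occur twice at them (`exists_extend_of_degree_eq_three`). In that case all
neighbors of `v` have degree `2 * k - 1`. If this happens for every choice of `v`, sparseness gives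
a vertex `x` with two neighbors `v`, `w` of degree at most `3` (`exists_two_low_neighbors`); here it
matters that `2 * k - 1` is odd. If `a` occurs at most once at `w`, recoloring `xw` with `a` makes
the coloring extend. Otherwise `w` has neighbors `x`, `p`, `q` with `wp` and `wq` of color `a`, and
therefore `p`, `q` are different from `y`, `z` (`exists_extend_or_neighbors`).

Now delete the edges at `w` and replace the edge `vx` by `vp`. The new graph is again sparse, with
fewer edges. In a coloring of it, `y`, `z` and `p` do not all miss the same single color once `v` is
removed, as otherwise the three edges at `v` would have this color. This is what is needed to color
the edges at `w` in such a way that the remaining edges at `v` can be colored as well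
(`exists_extend_two_vertices`).

Graphs of treewidth at most `3` are sparse by `TreeDecomposition.isHereditarilySparse`.
-/

namespace SimpleGraph

/-! ### Disjoint unions of paths -/

/-- A graph is a disjoint union of paths when it is acyclic with all degrees at most `2`; this is
the form of `IsLinearForest` that is convenient for adding and removing edges. -/
def IsPathUnion {V : Type*} (H : SimpleGraph V) : Prop :=
  H.IsAcyclic ∧ ∀ v, (H.neighborSet v).ncard ≤ 2

section PathUnion

variable {V : Type*} {H : SimpleGraph V}

lemma neighborSet_sup_edge_of_ne {u v a : V} (hu : a ≠ u) (hv : a ≠ v) :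
    (H ⊔ edge u v).neighborSet a = H.neighborSet a := by
  ext b; simp [edge_adj, hu, hv]

lemma neighborSet_sup_edge_subset {u v : V} :
    (H ⊔ edge u v).neighborSet u ⊆ insert v (H.neighborSet u) := by
  intro b hb
  simp [edge_adj] at hb ⊢
  grind

lemma not_reachable_of_neighborSet_eq_empty {u v : V} (huv : u ≠ v)
    (hu : H.neighborSet u = ∅) : ¬ H.Reachable u v := by
  rintro ⟨p⟩
  have : p.snd ∈ H.neighborSet u := p.adj_snd (fun h => huv h.eq)
  simp [hu] at this

lemma mem_support_of_reachable_of_closed {u v s t : V} {p : H.Walk u v}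
    (hcl : ∀ a b, a ∈ p.support → H.Adj a b → b ∈ p.support)
    (hs : s ∈ p.support) (hst : H.Reachable s t) : t ∈ p.support := by
  obtain ⟨q⟩ := hst
  induction q with
  | nil => exact hs
  | cons h _ ih => exact ih (hcl _ _ hs h)

variable [Finite V]

lemma IsPathUnion.anti {H' : SimpleGraph V} (hle : H' ≤ H) (hH : H.IsPathUnion) :
    H'.IsPathUnion :=
  ⟨hH.1.anti hle, fun v => (Set.ncard_le_ncard (fun _ h => hle h)).trans (hH.2 v)⟩

/-- The inner vertices of a path already have two neighbors on it. -/
lemma IsPathUnion.mem_support_of_adj_internal (hH : H.IsPathUnion) {u v : V} {p : H.Walk u v}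
    (hp : p.IsPath) {s t : V} (hs : s ∈ p.support) (hsu : s ≠ u) (hsv : s ≠ v)
    (hst : H.Adj s t) : t ∈ p.support := by
  obtain ⟨i, rfl, hi⟩ := Walk.mem_support_iff_exists_getVert.1 hs
  have h0 : i ≠ 0 := by rintro rfl; simp at hsu
  have h1 : i < p.length := lt_of_le_of_ne hi (by rintro rfl; simp at hsv)
  have h2 := hp.ncard_neighborSet_toSubgraph_internal_eq_two h0 h1
  have heq : p.toSubgraph.neighborSet (p.getVert i) = H.neighborSet (p.getVert i) :=
    Set.eq_of_subset_of_ncard_le (p.toSubgraph.neighborSet_subset _)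
      (by rw [h2]; exact hH.2 _)
  have : t ∈ p.toSubgraph.neighborSet (p.getVert i) := heq ▸ hst
  exact p.mem_verts_toSubgraph.1 (p.toSubgraph.edge_vert (Subgraph.Adj.symm this))

/-- The first vertex of a path has a neighbor on it, and no other one if its degree is `1`. -/
lemma mem_support_of_adj_start {u v : V} {p : H.Walk u v} (huv : u ≠ v)
    (hu : (H.neighborSet u).ncard ≤ 1) {t : V} (hst : H.Adj u t) : t ∈ p.support := by
  have hnil : ¬ p.Nil := fun h => huv h.eq
  have : t = p.snd := (Set.ncard_le_one (Set.toFinite _)).1 hu t hst p.snd (p.adj_snd hnil)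
  exact this ▸ p.getVert_mem_support 1

/-- A path has only two ends. -/
lemma IsPathUnion.not_reachable_three (hH : H.IsPathUnion) {x y z : V} (hxy : x ≠ y) (hxz : x ≠ z)
    (hyz : y ≠ z) (hx : (H.neighborSet x).ncard ≤ 1) (hy : (H.neighborSet y).ncard ≤ 1)
    (hz : (H.neighborSet z).ncard ≤ 1) (h1 : H.Reachable x y) : ¬ H.Reachable x z := by
  intro h2
  obtain ⟨p, hp⟩ := h1.exists_isPath
  have hcl : ∀ a b, a ∈ p.support → H.Adj a b → b ∈ p.support := by
    intro a b ha hab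
    by_cases hax : a = x
    · subst hax; exact mem_support_of_adj_start hxy hx hab
    by_cases hay : a = y
    · subst hay
      have := mem_support_of_adj_start (p := p.reverse) hxy.symm hy hab
      simpa using this
    exact hH.mem_support_of_adj_internal hp ha hax hay hab
  obtain ⟨i, hi, hil⟩ := Walk.mem_support_iff_exists_getVert.1
    (mem_support_of_reachable_of_closed hcl p.start_mem_support h2)
  have h0 : i ≠ 0 := by rintro rfl; simp at hi; exact hxz hi
  have h1 : i < p.length := lt_of_le_of_ne hil (by rintro rfl; simp at hi; exact hyz hi)
  have h3 := hp.ncard_neighborSet_toSubgraph_internal_eq_two h0 h1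
  have h4 := Set.ncard_le_ncard (p.toSubgraph.neighborSet_subset (p.getVert i))
  rw [hi] at h3 h4
  omega

/-- In each component, a longest path is the whole component. -/
theorem IsPathUnion.isLinearForest (hH : H.IsPathUnion) : H.IsLinearForest := by
  classical
  have := Fintype.ofFinite V
  refine ⟨hH.1, fun c => ?_⟩
  obtain ⟨r, rfl⟩ := c.exists_rep
  let P : ℕ → Prop := fun n => ∃ (u v : V) (p : H.Walk u v),
    p.IsPath ∧ p.length = n ∧ H.Reachable r u
  have hP0 : P 0 := ⟨r, r, .nil, .nil, rfl, .refl _⟩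
  have hPb : ∀ n, P n → n ≤ Fintype.card V := by
    rintro n ⟨u, v, p, hp, rfl, -⟩
    exact hp.length_lt.le
  have hPm := Nat.findGreatest_spec (P := P) (Nat.zero_le (Fintype.card V)) hP0
  obtain ⟨u, v, p, hp, hlen, hru⟩ := hPm
  have hmax : ∀ n, P n → n ≤ p.length := fun n hn => by
    rw [hlen]; exact Nat.le_findGreatest (hPb n hn) hn
  have hcl : ∀ a b, a ∈ p.support → H.Adj a b → b ∈ p.support := by
    intro a b ha hab
    by_contra hb
    by_cases hau : a = u
    · subst hau
      have := hmax _ ⟨b, v, .cons hab.symm p, hp.cons hb, rfl, hru.trans hab.reachable⟩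
      simp at this
    by_cases hav : a = v
    · subst hav
      have := hmax _ ⟨u, b, p.concat hab, hp.concat hb hab, rfl, hru⟩
      simp at this
    exact hb (hH.mem_support_of_adj_internal hp ha hau hav hab)
  have hsupp : (H.connectedComponentMk r).supp = {w | w ∈ p.support} := by
    ext w
    simp only [ConnectedComponent.mem_supp_iff, ConnectedComponent.eq, Set.mem_ofPred_eq]
    refine ⟨fun h => mem_support_of_reachable_of_closed hcl p.start_mem_support
      (hru.symm.trans h.symm),
      fun h => ?_⟩
    exact ((p.takeUntil w h).reachable.symm).trans hru.symm
  refine ⟨u, v, p, hp, ?_⟩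
  change (⊤ : H.Subgraph).induce (H.connectedComponentMk r).supp = _
  rw [hsupp]
  ext a b
  · simp
  simp only [Subgraph.induce_adj, Set.mem_ofPred_eq, Subgraph.top_adj]
  refine ⟨fun ⟨ha, hb, hab⟩ => ?_, fun h => ?_⟩
  · -- the edge `ab` is a bridge, so it lies on the walk from `a` to `b` along `p`
    have hbr := isBridge_iff_forall_walk_mem_edges.1
      (isAcyclic_iff_forall_adj_isBridge.1 hH.1 hab)
      ((p.takeUntil a ha).reverse.append (p.takeUntil b hb))
    rw [Walk.adj_toSubgraph_iff_mem_edges]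
    simp only [Walk.edges_append, Walk.edges_reverse, List.mem_append, List.mem_reverse] at hbr
    exact hbr.elim (fun h => p.edges_takeUntil_subset_edges ha h)
      (fun h => p.edges_takeUntil_subset_edges hb h)
  · have ha := p.toSubgraph.edge_vert h
    have hb := p.toSubgraph.edge_vert h.symm
    exact ⟨by simpa using ha, by simpa using hb, h.adj_sub⟩

lemma IsPathUnion.sup_edge (hH : H.IsPathUnion) {u v : V} (huv : ¬ H.Reachable u v)
    (hu : (H.neighborSet u).ncard ≤ 1) (hv : (H.neighborSet v).ncard ≤ 1) :
    (H ⊔ edge u v).IsPathUnion := by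
  refine ⟨hH.1.sup_edge_of_not_reachable huv, fun a => ?_⟩
  by_cases hau : a = u
  · subst hau
    exact (Set.ncard_le_ncard neighborSet_sup_edge_subset).trans
      ((Set.ncard_insert_le _ _).trans (by omega))
  by_cases hav : a = v
  · subst hav
    rw [edge_comm]
    exact (Set.ncard_le_ncard neighborSet_sup_edge_subset).trans
      ((Set.ncard_insert_le _ _).trans (by omega))
  rw [neighborSet_sup_edge_of_ne hau hav]
  exact hH.2 a

lemma not_reachable_of_ncard_eq_zero {u v : V} (huv : u ≠ v)
    (hu : (H.neighborSet u).ncard = 0) : ¬ H.Reachable u v :=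
  not_reachable_of_neighborSet_eq_empty huv ((Set.ncard_eq_zero (Set.toFinite _)).1 hu)

/-- Joining an isolated vertex to at most two path ends, of different paths, keeps a disjoint union
of paths. -/
lemma IsPathUnion.of_star {H' : SimpleGraph V} (hH : H.IsPathUnion) {v : V}
    (hv : H.neighborSet v = ∅) (A : Set V) (hvA : v ∉ A) (hA : A.ncard ≤ 2)
    (hdeg : ∀ x ∈ A, (H.neighborSet x).ncard ≤ 1)
    (hsep : ∀ x ∈ A, ∀ y ∈ A, x ≠ y → ¬ H.Reachable x y)
    (hH' : ∀ a b, H'.Adj a b → H.Adj a b ∨ (a = v ∧ b ∈ A) ∨ (b = v ∧ a ∈ A)) :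
    H'.IsPathUnion := by
  have hone : ∀ x ∈ A, (H ⊔ edge v x).IsPathUnion := fun x hx =>
    hH.sup_edge (not_reachable_of_neighborSet_eq_empty (by rintro rfl; exact hvA hx) hv)
      (by simp [hv]) (hdeg x hx)
  obtain h | h | h : A.ncard = 0 ∨ A.ncard = 1 ∨ A.ncard = 2 := by omega
  · rw [Set.ncard_eq_zero (Set.toFinite _)] at h
    subst h
    exact hH.anti fun a b hab => by simpa using hH' a b hab
  · obtain ⟨x, rfl⟩ := Set.ncard_eq_one.1 h
    refine (hone x rfl).anti fun a b hab => ?_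
    have := hH' a b hab
    have := hab.ne
    simp [edge_adj]
    grind
  · obtain ⟨x, y, hxy, rfl⟩ := Set.ncard_eq_two.1 h
    have hvx : v ≠ x := by rintro rfl; simp at hvA
    have hvy : v ≠ y := by rintro rfl; simp at hvA
    have hy1 : ((H ⊔ edge v x).neighborSet y).ncard ≤ 1 := by
      rw [neighborSet_sup_edge_of_ne hvy.symm hxy.symm]
      exact hdeg y (by simp)
    have hv1 : ((H ⊔ edge v x).neighborSet v).ncard ≤ 1 :=
      (Set.ncard_le_ncard neighborSet_sup_edge_subset).trans (by simp [hv])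
    -- the component of `y` is untouched by the edge `vx`
    have hnr : ¬ (H ⊔ edge v x).Reachable y v := by
      rintro ⟨p⟩
      have key : ∀ {a b : V} (p : (H ⊔ edge v x).Walk a b), b = v → ¬ H.Reachable y a := by
        intro a b p
        induction p with
        | nil =>
          rintro rfl h
          exact not_reachable_of_neighborSet_eq_empty hvy hv h.symm
        | @cons a a' b hadj q ih =>
          intro hb h'
          rw [sup_adj, edge_adj] at hadj
          rcases hadj with hadj | ⟨⟨rfl, -⟩ | ⟨rfl, -⟩, -⟩
          · exact ih hb (h'.trans hadj.reachable)
          · exact not_reachable_of_neighborSet_eq_empty hvy hv h'.symm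
          · exact hsep _ (by simp) y (by simp) hxy h'.symm
      exact key p rfl (.refl _)
    refine ((hone x (by simp)).sup_edge (fun h => hnr h.symm) hv1 hy1).anti fun a b hab => ?_
    have := hH' a b hab
    have := hab.ne
    simp [edge_adj]
    grind

end PathUnion

/-! ### Extending a coloring to a vertex -/

section Coloring

variable {V K : Type*}

/-- The graph of the edges of `G` with color `i`. Colorings are given by functions on all unordered
pairs; only the values on the edges of `G` matter. -/
def colorClass (G : SimpleGraph V) (c : Sym2 V → K) (i : K) : SimpleGraph V where
  Adj a b := G.Adj a b ∧ c s(a, b) = i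
  symm := ⟨fun a b h => ⟨h.1.symm, by rw [Sym2.eq_swap]; exact h.2⟩⟩
  loopless := ⟨fun _ h => h.1.ne rfl⟩

/-- A linear coloring: each color class is a disjoint union of paths. -/
def IsLinearColoring (G : SimpleGraph V) (c : Sym2 V → K) : Prop :=
  ∀ i, (G.colorClass c i).IsPathUnion

/-- The number of edges with color `i` at `x`. -/
noncomputable def colorDegree (G : SimpleGraph V) (c : Sym2 V → K) (i : K) (x : V) : ℕ :=
  ((G.colorClass c i).neighborSet x).ncard

/-- The colors that can be given to a further edge at `x`: those that occur at most once there. -/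
def availableColors (G : SimpleGraph V) (c : Sym2 V → K) (x : V) : Set K :=
  {i | G.colorDegree c i x ≤ 1}

/-- A set of colors available at `x` which either leaves a choice, or consists of a single color
that does not occur at `x` at all. -/
structure IsGoodList (G : SimpleGraph V) (c : Sym2 V → K) (x : V) (A : Set K) : Prop where
  nonempty : A.Nonempty
  le_one : ∀ i ∈ A, G.colorDegree c i x ≤ 1
  eq_zero : ∀ i, A = {i} → G.colorDegree c i x = 0

variable {G : SimpleGraph V} {c : Sym2 V → K}

@[simp] lemma colorClass_adj {i : K} {a b : V} :
    (G.colorClass c i).Adj a b ↔ G.Adj a b ∧ c s(a, b) = i := Iff.rfl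

lemma colorDegree_congr {G' : SimpleGraph V} {c' : Sym2 V → K} {x : V} {i : K}
    (h : ∀ b, G.Adj x b ∧ c s(x, b) = i ↔ G'.Adj x b ∧ c' s(x, b) = i) :
    G.colorDegree c i x = G'.colorDegree c' i x := by
  unfold colorDegree
  congr 1
  ext b
  simpa using h b

lemma colorDegree_mono [Finite V] {G' : SimpleGraph V} {c' : Sym2 V → K} {x : V} {i : K}
    (h : ∀ b, G.Adj x b → c s(x, b) = i → G'.Adj x b ∧ c' s(x, b) = i) :
    G.colorDegree c i x ≤ G'.colorDegree c' i x :=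
  Set.ncard_le_ncard fun b hb => h b hb.1 hb.2

lemma colorDegree_pos [Finite V] {x y : V} (h : G.Adj x y) : 0 < G.colorDegree c (c s(x, y)) x :=
  (Set.ncard_pos (Set.toFinite _)).2 ⟨y, h, rfl⟩

lemma sum_colorDegree [Finite V] [Fintype K] (x : V) :
    ∑ i, G.colorDegree c i x = (G.neighborSet x).ncard := by
  classical
  have := Fintype.ofFinite V
  have h := Finset.card_eq_sum_card_fiberwise (s := (G.neighborSet x).toFinset)
    (t := (Finset.univ : Finset K)) (f := fun b => c s(x, b)) (fun _ _ => by simp)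
  rw [Set.ncard_eq_toFinset_card', h]
  refine Finset.sum_congr rfl fun i _ => ?_
  rw [colorDegree, Set.ncard_eq_toFinset_card']
  congr 1
  ext b
  simp

/-- If all colors other than `a` occur twice at `x`, then there are many edges at `x`. -/
lemma two_mul_card_le_of_forall_ne [Finite V] [Fintype K] {x : V} (a : K)
    (h : ∀ i, i ≠ a → 2 ≤ G.colorDegree c i x) :
    2 * Fintype.card K + G.colorDegree c a x ≤ (G.neighborSet x).ncard + 2 := by
  classical
  rw [← sum_colorDegree (c := c), ← Finset.add_sum_erase _ _ (Finset.mem_univ a)]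
  have h1 : (Finset.univ.erase a).card • 2 ≤
      ∑ i ∈ Finset.univ.erase a, G.colorDegree c i x :=
    Finset.card_nsmul_le_sum _ _ _ fun i hi => h i (Finset.ne_of_mem_erase hi)
  rw [Finset.card_erase_of_mem (Finset.mem_univ a), Finset.card_univ, smul_eq_mul] at h1
  have : 0 < Fintype.card K := Fintype.card_pos_iff.2 ⟨a⟩
  omega

lemma two_mul_card_le_of_availableColors_eq [Finite V] [Fintype K] {x : V} {a : K}
    (ha : G.availableColors c x = {a}) :
    2 * Fintype.card K + G.colorDegree c a x ≤ (G.neighborSet x).ncard + 2 :=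
  two_mul_card_le_of_forall_ne a fun i hi => by
    by_contra hlt
    have : i ∈ G.availableColors c x := by
      simp only [availableColors, Set.mem_ofPred_eq]; omega
    rw [ha] at this
    exact hi this

lemma isGoodList_availableColors [Finite V] [Fintype K] {x : V}
    (h : (G.neighborSet x).ncard + 2 ≤ 2 * Fintype.card K) :
    IsGoodList G c x (G.availableColors c x) := by
  have hK : 0 < Fintype.card K := by omega
  obtain ⟨k₀⟩ := Fintype.card_pos_iff.1 hK
  have hne : (G.availableColors c x).Nonempty := by
    by_contra hne
    have hall : ∀ i, 2 ≤ G.colorDegree c i x := fun i => by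
      by_contra hi
      exact hne ⟨i, by simp only [availableColors, Set.mem_ofPred_eq]; omega⟩
    have := two_mul_card_le_of_forall_ne k₀ fun i _ => hall i
    have := hall k₀
    omega
  refine ⟨hne, fun i hi => hi, fun a ha => ?_⟩
  have := two_mul_card_le_of_availableColors_eq ha
  omega

lemma availableColors_ne_singleton [Finite V] [Fintype K] {x : V}
    (h : (G.neighborSet x).ncard + 3 ≤ 2 * Fintype.card K) (a : K) :
    G.availableColors c x ≠ {a} := fun ha => by
  have := two_mul_card_le_of_availableColors_eq ha
  omega

lemma isGoodList_singleton {x : V} {a : K} (h : G.colorDegree c a x = 0) :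
    IsGoodList G c x {a} :=
  ⟨⟨a, rfl⟩, fun i hi => by rw [Set.mem_singleton_iff.1 hi, h]; omega,
    fun i hi => by rw [← Set.singleton_eq_singleton_iff.1 hi, h]⟩

/-- A coloring of the graph without `v` extends to the edges at `v` if each color is used for at
most two of them, and these lead to ends of different paths. -/
lemma exists_extend_star [Finite V] {v : V}
    (hc : (G.deleteIncidenceSet v).IsLinearColoring c) (f : V → K)
    (hdeg : ∀ x, G.Adj v x → (G.deleteIncidenceSet v).colorDegree c (f x) x ≤ 1)
    (hcard : ∀ i, {x | G.Adj v x ∧ f x = i}.ncard ≤ 2)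
    (hsep : ∀ x y, G.Adj v x → G.Adj v y → x ≠ y → f x = f y →
      ¬ ((G.deleteIncidenceSet v).colorClass c (f x)).Reachable x y) :
    ∃ c' : Sym2 V → K, G.IsLinearColoring c' ∧ (∀ e, v ∉ e → c' e = c e) ∧
      ∀ x, c' s(v, x) = f x := by
  classical
  let c' : Sym2 V → K := fun e => if h : v ∈ e then f (Sym2.Mem.other h) else c e
  have hoff : ∀ e, v ∉ e → c' e = c e := fun e he => dif_neg he
  have hon : ∀ x, c' s(v, x) = f x := fun x => by
    have hm : v ∈ s(v, x) := Sym2.mem_mk_left v x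
    have h2 : Sym2.Mem.other hm = x := Sym2.congr_right.1 (Sym2.other_spec hm)
    simp only [c', dif_pos hm, h2]
  refine ⟨c', fun i => ?_, hoff, hon⟩
  refine (hc i).of_star (v := v) ?_ {x | G.Adj v x ∧ f x = i} (by simp) (hcard i) ?_ ?_ ?_
  · ext b; simp [deleteIncidenceSet_adj]
  · rintro x ⟨hx, rfl⟩; exact hdeg x hx
  · rintro x ⟨hx, rfl⟩ y ⟨hy, hxy⟩ hne
    exact hsep x y hx hy hne hxy.symm
  · rintro a b ⟨hab, hi⟩
    by_cases ha : a = v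
    · subst ha; exact .inr (.inl ⟨rfl, hab, by rw [← hi, hon]⟩)
    by_cases hb : b = v
    · subst hb
      exact .inr (.inr ⟨rfl, hab.symm, by rw [← hi, Sym2.eq_swap, hon]⟩)
    · left
      rw [hoff _ (by simp [Ne.symm ha, Ne.symm hb])] at hi
      exact ⟨(deleteIncidenceSet_adj ..).2 ⟨hab, ha, hb⟩, hi⟩

lemma exists_mem_ne {A : Set K} {a : K} (hA : A.Nonempty) (h : A ≠ {a}) : ∃ b ∈ A, b ≠ a := by
  by_contra! hall
  exact h (Set.eq_singleton_iff_nonempty_unique_mem.2 ⟨hA, hall⟩)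

lemma exists_pair_choice {A B : Set K} {R : K → Prop} (hA : A.Nonempty) (hB : B.Nonempty)
    (hAR : ∀ a, A = {a} → ¬ R a) : ∃ α ∈ A, ∃ β ∈ B, α = β → ¬ R α := by
  obtain ⟨β, hβ⟩ := hB
  by_cases h : A = {β}
  · exact ⟨β, by simp [h], β, hβ, fun _ => hAR β h⟩
  · obtain ⟨α, hα, hne⟩ := exists_mem_ne hA h
    exact ⟨α, hα, β, hβ, fun he => (hne he).elim⟩

/-- The case of `exists_triple_choice` in which the first list is a single color and the second
list contains another one. -/
lemma exists_triple_choice_of_singleton {B C : Set K} {Rab Rac Rbc : K → Prop} {a b : K}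
    (hC : C.Nonempty) (hac : ¬ Rac a) (hCR : ∀ i, C = {i} → ¬ Rbc i) (hb : b ∈ B) (hba : b ≠ a) :
    ∃ β ∈ B, ∃ γ ∈ C, ¬ (a = β ∧ β = γ) ∧ (a = β → ¬ Rab a) ∧ (a = γ → ¬ Rac a) ∧
      (β = γ → ¬ Rbc β) := by
  by_cases h : C = {b}
  · exact ⟨b, hb, b, by simp [h], fun h' => hba h'.1.symm, fun h' => (hba h'.symm).elim,
      fun _ => hac, fun _ => hCR b h⟩
  · obtain ⟨γ, hγ, hne⟩ := exists_mem_ne hC h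
    exact ⟨b, hb, γ, hγ, fun h' => hba h'.1.symm, fun h' => (hba h'.symm).elim,
      fun _ => hac, fun h' => (hne h'.symm).elim⟩

/-- Three lists of colors for the edges from a new vertex to `x`, `y`, `z`, where `Rab i` says
that `x` and `y` are ends of the same path of color `i`, and so on. Unless all three lists are the
same single color, the edges can be colored from their lists so that no color is used three times
and no cycle is closed. -/
lemma exists_triple_choice {A B C : Set K} {Rab Rac Rbc : K → Prop}
    (hA : A.Nonempty) (hB : B.Nonempty) (hC : C.Nonempty)
    (hAR : ∀ i, A = {i} → ¬ Rab i ∧ ¬ Rac i) (hBR : ∀ i, B = {i} → ¬ Rab i ∧ ¬ Rbc i)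
    (hCR : ∀ i, C = {i} → ¬ Rac i ∧ ¬ Rbc i)
    (h3 : ∀ i, i ∈ A → i ∈ B → i ∈ C → ¬ Rab i ∨ ¬ Rac i ∨ ¬ Rbc i)
    (hne : ¬ ∃ a, A = {a} ∧ B = {a} ∧ C = {a}) :
    ∃ α ∈ A, ∃ β ∈ B, ∃ γ ∈ C, ¬ (α = β ∧ β = γ) ∧ (α = β → ¬ Rab α) ∧ (α = γ → ¬ Rac α) ∧
      (β = γ → ¬ Rbc β) := by
  by_cases hA1 : ∃ a, A = {a}
  · obtain ⟨a, rfl⟩ := hA1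
    by_cases hBa : B = {a}
    · obtain ⟨b, hb, hba⟩ := exists_mem_ne hC (fun h => hne ⟨a, rfl, hBa, h⟩)
      obtain ⟨γ, hγ, β, hβ, h⟩ := exists_triple_choice_of_singleton (Rab := Rac) (Rac := Rab)
        (Rbc := Rbc) hB (hAR a rfl).1 (fun i hi => (hBR i hi).2) hb hba
      exact ⟨a, rfl, β, hβ, γ, hγ, by grind⟩
    · obtain ⟨b, hb, hba⟩ := exists_mem_ne hB hBa
      exact ⟨a, rfl, exists_triple_choice_of_singleton hC (hAR a rfl).2
        (fun i hi => (hCR i hi).2) hb hba⟩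
  by_cases hB1 : ∃ b, B = {b}
  · obtain ⟨b, rfl⟩ := hB1
    obtain ⟨a, ha, hab⟩ := exists_mem_ne hA (fun h => hA1 ⟨b, h⟩)
    obtain ⟨α, hα, γ, hγ, h⟩ := exists_triple_choice_of_singleton (Rab := Rab) (Rac := Rbc)
      (Rbc := Rac) hC (hBR b rfl).2 (fun i hi => (hCR i hi).1) ha hab
    exact ⟨α, hα, b, rfl, γ, hγ, by grind⟩
  by_cases hC1 : ∃ d, C = {d}
  · obtain ⟨d, rfl⟩ := hC1
    obtain ⟨a, ha, had⟩ := exists_mem_ne hA (fun h => hA1 ⟨d, h⟩)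
    obtain ⟨α, hα, β, hβ, h⟩ := exists_triple_choice_of_singleton (Rab := Rac) (Rac := Rbc)
      (Rbc := Rab) hB (hCR d rfl).2 (fun i hi => (hBR i hi).1) ha had
    exact ⟨α, hα, β, hβ, d, rfl, by grind⟩
  -- All lists have two colors. Without distinct representatives they are the same two colors.
  obtain ⟨α, hα⟩ := hA
  obtain ⟨β, hβ, hβα⟩ := exists_mem_ne hB (fun h => hB1 ⟨α, h⟩)
  by_cases hγ : ∃ γ ∈ C, γ ≠ α ∧ γ ≠ β
  · obtain ⟨γ, hγ, h1, h2⟩ := hγ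
    exact ⟨α, hα, β, hβ, γ, hγ, by grind⟩
  push Not at hγ
  have hCα : α ∈ C := by
    obtain ⟨γ, h1, h2⟩ := exists_mem_ne hC (fun h => hC1 ⟨β, h⟩)
    grind
  have hCβ : β ∈ C := by
    obtain ⟨γ, h1, h2⟩ := exists_mem_ne hC (fun h => hC1 ⟨α, h⟩)
    grind
  obtain ⟨α', hα', hne1⟩ := exists_mem_ne ⟨α, hα⟩ (fun h => hA1 ⟨α, h⟩)
  by_cases h1 : α' = β
  · subst h1
    obtain ⟨β', hβ', hne2⟩ := exists_mem_ne ⟨α', hβ⟩ (fun h => hB1 ⟨α', h⟩)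
    by_cases h2 : β' = α
    · subst h2
      -- one of the two colors may be repeated, as its path ends at only two of `x`, `y`, `z`
      rcases h3 β' hα hβ' hCα with h | h | h
      · exact ⟨β', hα, β', hβ', α', hCβ, by grind⟩
      · exact ⟨β', hα, α', hβ, β', hCα, by grind⟩
      · exact ⟨α', hα', β', hβ', β', hCα, by grind⟩
    · exact ⟨α, hα, β', hβ', α', hCβ, by grind⟩
  · exact ⟨α', hα', β, hβ, α, hCα, by grind⟩

lemma IsGoodList.not_reachable [Finite V] {x y : V} {A : Set K} (h : IsGoodList G c x A)
    (hxy : x ≠ y) {i : K} (hi : A = {i}) : ¬ (G.colorClass c i).Reachable x y :=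
  not_reachable_of_ncard_eq_zero hxy (h.eq_zero i hi)

/-- Extension of a coloring to a vertex of degree at most `2`. -/
lemma exists_extend_of_degree_le_two [Finite V] {v x y : V} {A B : Set K}
    (hc : (G.deleteIncidenceSet v).IsLinearColoring c)
    (hv : ∀ t, G.Adj v t → t = x ∨ t = y)
    (hA : IsGoodList (G.deleteIncidenceSet v) c x A)
    (hB : IsGoodList (G.deleteIncidenceSet v) c y B) :
    ∃ c' : Sym2 V → K, G.IsLinearColoring c' := by
  classical
  obtain ⟨α, hα, β, hβ, hR⟩ := exists_pair_choice
    (R := fun i => x ≠ y ∧ ((G.deleteIncidenceSet v).colorClass c i).Reachable x y)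
    hA.nonempty hB.nonempty (fun i hi h => hA.not_reachable h.1 hi h.2)
  refine (exists_extend_star hc (fun t => if t = x then α else β) ?_ ?_ ?_).imp
    fun c' hc' => hc'.1
  · intro t ht
    by_cases htx : t = x
    · subst htx; simpa using hA.le_one α hα
    · obtain rfl := (hv t ht).resolve_left htx
      simpa [htx] using hB.le_one β hβ
  · intro i
    refine (Set.ncard_le_ncard (t := {x, y}) fun t ht => ?_).trans
      ((Set.ncard_insert_le x {y}).trans (by simp))
    simpa using hv t ht.1
  · intro s t hs ht hst he hr
    rcases hv s hs with rfl | rfl <;> rcases hv t ht with rfl | rfl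
    · exact hst rfl
    · simp only [if_true, if_neg hst.symm] at he hr
      exact hR he ⟨hst, hr⟩
    · simp only [if_true, if_neg hst] at he hr
      exact hR he.symm ⟨hst.symm, he ▸ hr.symm⟩
    · exact hst rfl

/-- Extension of a coloring to a vertex of degree `3`, with colors from good lists at its neighbors:
this is possible unless the three lists are the same single color. -/
lemma exists_extend_of_degree_eq_three [Finite V] {v x y z : V} {A B C : Set K}
    (hc : (G.deleteIncidenceSet v).IsLinearColoring c)
    (hv : ∀ t, G.Adj v t ↔ t = x ∨ t = y ∨ t = z) (hxy : x ≠ y) (hxz : x ≠ z) (hyz : y ≠ z)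
    (hA : IsGoodList (G.deleteIncidenceSet v) c x A)
    (hB : IsGoodList (G.deleteIncidenceSet v) c y B)
    (hC : IsGoodList (G.deleteIncidenceSet v) c z C)
    (hne : ¬ ∃ a, A = {a} ∧ B = {a} ∧ C = {a}) :
    ∃ c' : Sym2 V → K, G.IsLinearColoring c' ∧ (∀ e, v ∉ e → c' e = c e) ∧
      c' s(v, x) ∈ A ∧ c' s(v, y) ∈ B ∧ c' s(v, z) ∈ C := by
  classical
  set H := G.deleteIncidenceSet v
  obtain ⟨α, hα, β, hβ, γ, hγ, hall, h1, h2, h3⟩ := exists_triple_choice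
    (Rab := fun i => (H.colorClass c i).Reachable x y)
    (Rac := fun i => (H.colorClass c i).Reachable x z)
    (Rbc := fun i => (H.colorClass c i).Reachable y z) hA.nonempty hB.nonempty hC.nonempty
    (fun i hi => ⟨hA.not_reachable hxy hi, hA.not_reachable hxz hi⟩)
    (fun i hi => ⟨fun h => hB.not_reachable hxy.symm hi h.symm, hB.not_reachable hyz hi⟩)
    (fun i hi => ⟨fun h => hC.not_reachable hxz.symm hi h.symm,
      fun h => hC.not_reachable hyz.symm hi h.symm⟩)
    (fun i hiA hiB hiC => by
      by_cases h : (H.colorClass c i).Reachable x y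
      · exact .inr (.inl ((hc i).not_reachable_three hxy hxz hyz (hA.le_one i hiA)
          (hB.le_one i hiB) (hC.le_one i hiC) h))
      · exact .inl h) hne
  let f : V → K := fun t => if t = x then α else if t = y then β else γ
  have hfx : f x = α := by simp [f]
  have hfy : f y = β := by simp [f, hxy.symm]
  have hfz : f z = γ := by simp [f, hxz.symm, hyz.symm]
  refine (exists_extend_star hc f ?_ ?_ ?_).imp fun c' hc' => ⟨hc'.1, hc'.2.1,
    by rw [hc'.2.2, hfx]; exact hα, by rw [hc'.2.2, hfy]; exact hβ,
    by rw [hc'.2.2, hfz]; exact hγ⟩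
  · intro t ht
    rcases (hv t).1 ht with rfl | rfl | rfl
    · rw [hfx]; exact hA.le_one α hα
    · rw [hfy]; exact hB.le_one β hβ
    · rw [hfz]; exact hC.le_one γ hγ
  · intro i
    have hsub : ∀ s t : V, (∀ u, (u = x ∨ u = y ∨ u = z) → f u = i → u = s ∨ u = t) →
        {u | G.Adj v u ∧ f u = i}.ncard ≤ 2 := fun s t h =>
      (Set.ncard_le_ncard (t := {s, t}) fun u hu => by simpa using h u ((hv u).1 hu.1) hu.2).trans
        ((Set.ncard_insert_le s {t}).trans (by simp))
    by_cases hx : α = i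
    · by_cases hy : β = i
      · exact hsub x y (by grind)
      · exact hsub x z (by grind)
    · exact hsub y z (by grind)
  · intro s t hs ht hst he hr
    rcases (hv s).1 hs with rfl | rfl | rfl <;> rcases (hv t).1 ht with rfl | rfl | rfl
    · exact hst rfl
    · rw [hfx, hfy] at he; rw [hfx] at hr; exact h1 he hr
    · rw [hfx, hfz] at he; rw [hfx] at hr; exact h2 he hr
    · rw [hfx, hfy] at he; rw [hfy, he] at hr; exact h1 he.symm hr.symm
    · exact hst rfl
    · rw [hfy, hfz] at he; rw [hfy] at hr; exact h3 he hr
    · rw [hfx, hfz] at he; rw [hfz, he] at hr; exact h2 he.symm hr.symm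
    · rw [hfy, hfz] at he; rw [hfz, he] at hr; exact h3 he.symm hr.symm
    · exact hst rfl

end Coloring

/-! ### Two vertices of degree three with a common neighbor -/

section Induction

variable {V K : Type*} [Finite V] {G : SimpleGraph V} {c : Sym2 V → K}

/-- The hereditary form of `t`-degeneracy: every nonempty set of vertices contains a vertex with at
most `t` neighbors in that set. -/
def IsHereditarilySparse {V : Type*} (G : SimpleGraph V) (t : ℕ) : Prop :=
  ∀ S : Set V, S.Nonempty → ∃ v ∈ S, {u | u ∈ S ∧ G.Adj v u}.ncard ≤ t

lemma IsHereditarilySparse.anti {G' : SimpleGraph V} {t : ℕ} (hle : G' ≤ G)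
    (h : G.IsHereditarilySparse t) : G'.IsHereditarilySparse t := fun S hS => by
  obtain ⟨v, hv, hcard⟩ := h S hS
  refine ⟨v, hv, le_trans (Set.ncard_le_ncard ?_) hcard⟩
  exact fun u hu => ⟨hu.1, hle hu.2⟩

lemma ncard_neighborSet_mono {G' : SimpleGraph V} (hle : G' ≤ G) (x : V) :
    (G'.neighborSet x).ncard ≤ (G.neighborSet x).ncard :=
  Set.ncard_le_ncard fun _ h => hle h

lemma ncard_neighborSet_deleteIncidenceSet_lt {v x : V} (h : G.Adj v x) :
    ((G.deleteIncidenceSet v).neighborSet x).ncard < (G.neighborSet x).ncard :=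
  Set.ncard_lt_ncard ⟨fun _ h => G.deleteIncidenceSet_le v h,
    fun hsub => ((deleteIncidenceSet_adj ..).1 (hsub h.symm)).2.2 rfl⟩

lemma ncard_edgeSet_deleteIncidenceSet_lt {v x : V} (h : G.Adj v x) :
    (G.deleteIncidenceSet v).edgeSet.ncard < G.edgeSet.ncard :=
  Set.ncard_lt_ncard ⟨edgeSet_mono (G.deleteIncidenceSet_le v),
    fun hsub => ((deleteIncidenceSet_adj ..).1 (hsub (G.mem_edgeSet.2 h))).2.1 rfl⟩

/-- Recoloring the edge `xw` with a color `a` that is missing at `x` and occurs at most once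
at `w`. -/
lemma IsLinearColoring.exists_recolor (hc : G.IsLinearColoring c) {x w : V} {a : K}
    (hxw : G.Adj x w) (hne : c s(x, w) ≠ a) (hx : G.colorDegree c a x = 0)
    (hw : G.colorDegree c a w ≤ 1) :
    ∃ c' : Sym2 V → K, G.IsLinearColoring c' ∧ G.colorDegree c' (c s(x, w)) x ≤ 1 ∧
      ∀ t, G.colorDegree c' a t ≤ G.colorDegree c a t + 1 := by
  classical
  refine ⟨Function.update c s(x, w) a, fun i => ?_, ?_, fun t => ?_⟩
  · by_cases hi : i = a
    · subst hi
      refine ((hc i).sup_edge (not_reachable_of_ncard_eq_zero hxw.ne hx)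
        (by unfold colorDegree at hx; omega) hw).anti fun s t hst => ?_
      by_cases he : s(s, t) = s(x, w)
      · exact .inr ((edge_adj ..).2 ⟨by simpa using he, hst.1.ne⟩)
      · exact .inl ⟨hst.1, by simpa [Function.update_of_ne he] using hst.2⟩
    · refine (hc i).anti fun s t hst => ?_
      by_cases he : s(s, t) = s(x, w)
      · have h2 := hst.2
        rw [he, Function.update_self] at h2
        exact (hi h2.symm).elim
      · exact ⟨hst.1, by simpa [Function.update_of_ne he] using hst.2⟩
  · have hlt : G.colorDegree (Function.update c s(x, w) a) (c s(x, w)) x <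
        G.colorDegree c (c s(x, w)) x := by
      refine Set.ncard_lt_ncard ⟨fun t ht => ?_, fun hsub => ?_⟩
      · have h2 := ht.2
        by_cases he : s(x, t) = s(x, w)
        · rw [he, Function.update_self] at h2
          exact (hne h2.symm).elim
        · exact ⟨ht.1, by simpa [Function.update_of_ne he] using h2⟩
      · have h2 := (hsub (show w ∈ _ from ⟨hxw, rfl⟩)).2
        rw [Function.update_self] at h2
        exact hne h2.symm
    have := (hc (c s(x, w))).2 x
    unfold colorDegree at *
    omega
  · refine (Set.ncard_le_ncard (t := insert (if t = x then w else x)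
      ((G.colorClass c a).neighborSet t)) fun u hu => ?_).trans (Set.ncard_insert_le _ _)
    by_cases he : s(t, u) = s(x, w)
    · left
      rcases Sym2.eq_iff.1 he with ⟨rfl, rfl⟩ | ⟨rfl, rfl⟩
      · simp
      · simp [hxw.ne']
    · exact .inr ⟨hu.1, by simpa [Function.update_of_ne he] using hu.2⟩

/-- In a graph where `v` is adjacent to `y`, `z`, `p`, these vertices cannot all miss the same
single color once `v` is removed. -/
lemma not_availableColors_eq_singleton {G' H : SimpleGraph V} {v y z p : V}
    (hc : G'.IsLinearColoring c) (hH : ∀ a b, H.Adj a b → G'.Adj a b ∧ a ≠ v ∧ b ≠ v)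
    (hy : G'.Adj v y) (hz : G'.Adj v z) (hp : G'.Adj v p) (hyz : y ≠ z) (hyp : y ≠ p)
    (hzp : z ≠ p) :
    ¬ ∃ a, H.availableColors c y = {a} ∧ H.availableColors c z = {a} ∧
      H.availableColors c p = {a} := by
  rintro ⟨a, hya, hza, hpa⟩
  have key : ∀ t, G'.Adj v t → H.availableColors c t = {a} → c s(v, t) = a := by
    intro t ht hta
    have hmem : c s(v, t) ∈ H.availableColors c t := by
      have h1 := (hc (c s(v, t))).2 t
      have h2 : H.colorDegree c (c s(v, t)) t < G'.colorDegree c (c s(v, t)) t :=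
        Set.ncard_lt_ncard ⟨fun u hu => ⟨(hH _ _ hu.1).1, hu.2⟩, fun hsub =>
          (hH _ _ (hsub (show v ∈ _ from ⟨ht.symm, by rw [Sym2.eq_swap]⟩)).1).2.2 rfl⟩
      simp only [availableColors, Set.mem_ofPred_eq]
      unfold colorDegree at *
      omega
    rw [hta] at hmem
    exact hmem
  have h3 : ({y, z, p} : Set V).ncard = 3 := Set.ncard_eq_three.2 ⟨y, z, p, hyz, hyp, hzp, rfl⟩
  have hle : ({y, z, p} : Set V).ncard ≤ ((G'.colorClass c a).neighborSet v).ncard := by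
    refine Set.ncard_le_ncard ?_
    rintro t (rfl | rfl | rfl)
    · exact ⟨hy, key _ hy hya⟩
    · exact ⟨hz, key _ hz hza⟩
    · exact ⟨hp, key _ hp hpa⟩
  have := (hc a).2 v
  omega

variable [Fintype K]

/-- If a coloring of the graph without `v` neither extends to `v` nor does so after recoloring the
edge `xw`, then the same color is missing at all neighbors of `v` and occurs twice at `w`, which
determines the graph near `v` and `w`. -/
lemma exists_extend_or_neighbors {v w x y z : V}
    (hdeg : ∀ t, (G.neighborSet t).ncard < 2 * Fintype.card K)
    (hc : (G.deleteIncidenceSet v).IsLinearColoring c)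
    (hv : ∀ t, G.Adj v t ↔ t = x ∨ t = y ∨ t = z) (hxy : x ≠ y) (hxz : x ≠ z) (hyz : y ≠ z)
    (hxw : G.Adj x w) (hvw : v ≠ w) (hw : (G.neighborSet w).ncard ≤ 3) :
    (∃ c' : Sym2 V → K, G.IsLinearColoring c') ∨
    (¬ G.Adj v w ∧ ∃ p q, (∀ t, G.Adj w t ↔ t = x ∨ t = p ∨ t = q) ∧ x ≠ p ∧ x ≠ q ∧ p ≠ q ∧
      p ≠ y ∧ p ≠ z ∧ q ≠ y ∧ q ≠ z) := by
  classical
  rw [or_iff_not_imp_left]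
  intro hno
  set H := G.deleteIncidenceSet v with hH
  have hlist : ∀ (c : Sym2 V → K) (t : V), G.Adj v t → IsGoodList H c t (H.availableColors c t) :=
    fun c t ht => isGoodList_availableColors (by
      have h1 : (H.neighborSet t).ncard < _ := ncard_neighborSet_deleteIncidenceSet_lt ht
      have h2 := hdeg t
      omega)
  have hbad : ∀ c : Sym2 V → K, H.IsLinearColoring c → ∃ a, H.availableColors c x = {a} ∧
      H.availableColors c y = {a} ∧ H.availableColors c z = {a} := fun c hc => by
    by_contra hne
    obtain ⟨c', hc', -⟩ := exists_extend_of_degree_eq_three hc hv hxy hxz hyz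
      (hlist c x ((hv x).2 (by simp))) (hlist c y ((hv y).2 (by simp)))
      (hlist c z ((hv z).2 (by simp))) hne
    exact hno ⟨c', hc'⟩
  obtain ⟨a, hxa, hya, hza⟩ := hbad c hc
  have hx0 := (hlist c x ((hv x).2 (by simp))).eq_zero a hxa
  have hy0 := (hlist c y ((hv y).2 (by simp))).eq_zero a hya
  have hz0 := (hlist c z ((hv z).2 (by simp))).eq_zero a hza
  have hvx : v ≠ x := ((hv x).2 (by simp)).ne
  have hxw' : H.Adj x w := (deleteIncidenceSet_adj ..).2 ⟨hxw, hvx.symm, hvw.symm⟩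
  have hne : c s(x, w) ≠ a := fun h => by
    have := colorDegree_pos (c := c) hxw'
    rw [h] at this
    omega
  have hw2 : 1 < H.colorDegree c a w := by
    by_contra hle
    obtain ⟨c', hc', h1, h2⟩ := hc.exists_recolor hxw' hne hx0 (not_lt.1 hle)
    obtain ⟨e, hxe, hye, -⟩ := hbad c' hc'
    have h3 : c s(x, w) ∈ H.availableColors c' x := h1
    have h4 : a ∈ H.availableColors c' y := (h2 y).trans (by omega)
    rw [hxe] at h3
    rw [hye] at h4
    exact hne (h3.trans h4.symm)
  obtain ⟨p, q, hp, hq, hpq⟩ := (Set.one_lt_ncard_iff (Set.toFinite _)).1 hw2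
  have hxp : x ≠ p := by
    rintro rfl; exact hne (by rw [Sym2.eq_swap]; exact hp.2)
  have hxq : x ≠ q := by
    rintro rfl; exact hne (by rw [Sym2.eq_swap]; exact hq.2)
  have hnb : G.neighborSet w = {x, p, q} := by
    refine (Set.eq_of_subset_of_ncard_le ?_ ?_).symm
    · rintro t (rfl | rfl | rfl)
      · exact hxw.symm
      · exact G.deleteIncidenceSet_le v hp.1
      · exact G.deleteIncidenceSet_le v hq.1
    · rw [Set.ncard_eq_three.2 ⟨x, p, q, hxp, hxq, hpq, rfl⟩]
      exact hw
  have hmiss : ∀ t u, H.colorDegree c a t = 0 → (H.colorClass c a).Adj w u → u ≠ t := by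
    rintro t u h0 hu rfl
    have := colorDegree_pos (c := c) hu.1.symm
    rw [Sym2.eq_swap, hu.2] at this
    omega
  refine ⟨fun h => ?_, p, q, fun t => ?_, hxp, hxq, hpq, hmiss y p hy0 hp, hmiss z p hz0 hp,
    hmiss y q hy0 hq, hmiss z q hz0 hq⟩
  · rcases (hv w).1 h with rfl | rfl | rfl
    · exact hxw.ne rfl
    · omega
    · omega
  · rw [← mem_neighborSet, hnb]; simp

/-- Let `v` and `w` be nonadjacent vertices of degree `3` with exactly one common neighbor `x`. A
coloring of the graph without `v` and `w` extends if the other neighbors `y`, `z` of `v` and some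
other neighbor `p` of `w` do not all miss the same single color. -/
lemma exists_extend_two_vertices {v w x y z p q : V}
    (hdeg : ∀ t, (G.neighborSet t).ncard < 2 * Fintype.card K)
    (hc : ((G.deleteIncidenceSet v).deleteIncidenceSet w).IsLinearColoring c)
    (hv : ∀ t, G.Adj v t ↔ t = x ∨ t = y ∨ t = z) (hxy : x ≠ y) (hxz : x ≠ z) (hyz : y ≠ z)
    (hw : ∀ t, G.Adj w t ↔ t = x ∨ t = p ∨ t = q) (hxp : x ≠ p) (hxq : x ≠ q) (hpq : p ≠ q)
    (hvw : ¬ G.Adj v w) (hpy : p ≠ y) (hpz : p ≠ z) (hqy : q ≠ y) (hqz : q ≠ z)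
    (hne : ¬ ∃ a, ((G.deleteIncidenceSet v).deleteIncidenceSet w).availableColors c y = {a} ∧
      ((G.deleteIncidenceSet v).deleteIncidenceSet w).availableColors c z = {a} ∧
      ((G.deleteIncidenceSet v).deleteIncidenceSet w).availableColors c p = {a}) :
    ∃ c' : Sym2 V → K, G.IsLinearColoring c' := by
  classical
  set G₁ := G.deleteIncidenceSet v with hG₁
  set H := G₁.deleteIncidenceSet w with hH
  have hvx : G.Adj v x := (hv x).2 (by simp)
  have hvy : G.Adj v y := (hv y).2 (by simp)
  have hvz : G.Adj v z := (hv z).2 (by simp)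
  have hvw' : v ≠ w := by
    rintro rfl
    rcases (hv p).1 ((hw p).2 (by simp)) with h | h | h
    · exact hxp h.symm
    · exact hpy h
    · exact hpz h
  have hw₁ : ∀ t, G₁.Adj w t ↔ t = x ∨ t = p ∨ t = q := fun t => by
    rw [hG₁, deleteIncidenceSet_adj, ← hw]
    exact ⟨fun h => h.1, fun h => ⟨h, hvw'.symm, fun htv => hvw (htv ▸ h.symm)⟩⟩
  have hHadj : ∀ a b, H.Adj a b ↔ G₁.Adj a b ∧ a ≠ w ∧ b ≠ w := fun _ _ =>
    deleteIncidenceSet_adj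
  have hdegx : (H.neighborSet x).ncard + 3 ≤ 2 * Fintype.card K := by
    have h1 : (H.neighborSet x).ncard < _ :=
      ncard_neighborSet_deleteIncidenceSet_lt ((hw₁ x).2 (by simp))
    have h2 : (G₁.neighborSet x).ncard < _ := ncard_neighborSet_deleteIncidenceSet_lt hvx
    have h3 := hdeg x
    omega
  have hlistH : ∀ t, G₁.Adj w t → IsGoodList H c t (H.availableColors c t) := fun t ht =>
    isGoodList_availableColors (by
      have h1 : (H.neighborSet t).ncard < _ := ncard_neighborSet_deleteIncidenceSet_lt ht
      have h2 : (G₁.neighborSet t).ncard ≤ _ :=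
        ncard_neighborSet_mono (G.deleteIncidenceSet_le v) t
      have h3 := hdeg t
      omega)
  have hlistG : ∀ (c : Sym2 V → K) t, G.Adj v t → IsGoodList G₁ c t (G₁.availableColors c t) :=
    fun c t ht => isGoodList_availableColors (by
      have h1 : (G₁.neighborSet t).ncard < _ := ncard_neighborSet_deleteIncidenceSet_lt ht
      have h2 := hdeg t
      omega)
  have hgx := hlistH x ((hw₁ x).2 (by simp))
  have hgp := hlistH p ((hw₁ p).2 (by simp))
  have hgq := hlistH q ((hw₁ q).2 (by simp))
  -- the available colors at `y` and `z` do not depend on the edges at `w`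
  have hsame : ∀ (c' : Sym2 V → K), (∀ e, w ∉ e → c' e = c e) → ∀ t, G.Adj v t → t ≠ x →
      G₁.availableColors c' t = H.availableColors c t := by
    intro c' hoff t ht htx
    have htw : t ≠ w := fun h => hvw (h ▸ ht)
    have hadj : ¬ G₁.Adj t w := fun h => by
      rcases (hv t).1 ht with rfl | rfl | rfl <;> rcases (hw₁ _).1 h.symm with h | h | h
      all_goals first | exact htx h | exact htx rfl | exact hpy h.symm | exact hqy h.symm |
        exact hpz h.symm | exact hqz h.symm
    ext i
    simp only [availableColors, Set.mem_ofPred_eq]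
    rw [colorDegree_congr (G := G₁) (G' := H) (c' := c)]
    intro b
    rw [hHadj]
    by_cases hb : b = w
    · subst hb; simp [hadj]
    · rw [hoff _ (by simp [Ne.symm htw, Ne.symm hb])]
      simp [htw, hb]
  -- it suffices to extend to the edges at `w` so that the lists at `v` are not all `{a}`
  have finish : ∀ c' : Sym2 V → K, G₁.IsLinearColoring c' → (∀ e, w ∉ e → c' e = c e) →
      (∀ a, H.availableColors c y = {a} → H.availableColors c z = {a} →
        G₁.availableColors c' x ≠ {a}) → ∃ c' : Sym2 V → K, G.IsLinearColoring c' := by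
    intro c' hc' hoff hx
    obtain ⟨c'', hc'', -⟩ := exists_extend_of_degree_eq_three hc' hv hxy hxz hyz
      (hlistG c' x hvx) (hlistG c' y hvy) (hlistG c' z hvz) (by
        rintro ⟨a, hxa, hya, hza⟩
        rw [hsame c' hoff y hvy hxy.symm] at hya
        rw [hsame c' hoff z hvz hxz.symm] at hza
        exact hx a hya hza hxa)
    exact ⟨c'', hc''⟩
  have hnotx : ∀ a, H.availableColors c x ≠ {a} := availableColors_ne_singleton hdegx
  by_cases hcase : ∃ a, H.availableColors c y = {a} ∧ H.availableColors c z = {a} ∧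
      H.colorDegree c a x = 0
  · obtain ⟨a, hya, hza, hxa⟩ := hcase
    have hpa : H.availableColors c p ≠ {a} := fun h => hne ⟨a, hya, hza, h⟩
    -- give `xw` the color `a`, so that another color stays available at `x`
    obtain ⟨c', hc', hoff, hx, -⟩ := exists_extend_of_degree_eq_three hc hw₁ hxp hxq hpq
      (isGoodList_singleton hxa) hgp hgq (by
        rintro ⟨e, h1, h2, -⟩
        rw [Set.singleton_eq_singleton_iff] at h1
        exact hpa (h1 ▸ h2))
    refine finish c' hc' hoff fun a' hya' _ hxa' => ?_
    obtain rfl : a = a' := by rw [hya] at hya'; exact Set.singleton_eq_singleton_iff.1 hya'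
    obtain ⟨b, hb, hba⟩ := exists_mem_ne hgx.nonempty (hnotx a)
    have hb' : b ∈ G₁.availableColors c' x := by
      refine (colorDegree_mono (G' := H) (c' := c) fun t ht htb => ?_).trans hb
      have htw : t ≠ w := by
        rintro rfl
        rw [Sym2.eq_swap] at htb
        exact hba (htb.symm.trans hx)
      have hxw : x ≠ w := ((hw x).2 (by simp)).ne'
      rw [hoff _ (by simp [htw.symm, hxw.symm])] at htb
      exact ⟨(deleteIncidenceSet_adj ..).2 ⟨ht, hxw, htw⟩, htb⟩
    rw [hxa'] at hb'
    exact hba hb'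
  · obtain ⟨c', hc', hoff, -⟩ := exists_extend_of_degree_eq_three hc hw₁ hxp hxq hpq
      hgx hgp hgq (by rintro ⟨a, h, -⟩; exact hnotx a h)
    refine finish c' hc' hoff fun a hya hza hxa => hcase ⟨a, hya, hza, ?_⟩
    have h0 := (hlistG c' x hvx).eq_zero a hxa
    have hle : H.colorDegree c a x ≤ G₁.colorDegree c' a x :=
      colorDegree_mono fun t ht hta => by
        rw [hHadj] at ht
        exact ⟨ht.1, by rw [hoff _ (by simp [ht.2.1.symm, ht.2.2.symm]), hta]⟩
    omega

end Induction

/-! ### The induction -/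

section Main

variable {V K : Type*} [Finite V] {G : SimpleGraph V} {c : Sym2 V → K}

lemma IsLinearColoring.anti {G' : SimpleGraph V} (hle : G' ≤ G) (hc : G.IsLinearColoring c) :
    G'.IsLinearColoring c := fun i => by
  refine (hc i).anti fun a b hab => ?_
  exact ⟨hle hab.1, hab.2⟩

variable [Fintype K]

/-- A coloring of the graph without the vertex `v` of degree at most `3` extends to `v` unless `v`
has degree `3` and all its neighbors have the largest degree allowed. -/
lemma neighbors_of_not_exists_extend {v : V}
    (hdeg : ∀ t, (G.neighborSet t).ncard < 2 * Fintype.card K)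
    (hc : (G.deleteIncidenceSet v).IsLinearColoring c)
    (hno : ¬ ∃ c' : Sym2 V → K, G.IsLinearColoring c')
    (hv0 : (G.neighborSet v).Nonempty) (hv3 : (G.neighborSet v).ncard ≤ 3) :
    (G.neighborSet v).ncard = 3 ∧
      ∀ t, G.Adj v t → (G.neighborSet t).ncard + 1 = 2 * Fintype.card K := by
  have hlist : ∀ t, G.Adj v t → IsGoodList (G.deleteIncidenceSet v) c t
      ((G.deleteIncidenceSet v).availableColors c t) := fun t ht =>
    isGoodList_availableColors (by
      have h1 := ncard_neighborSet_deleteIncidenceSet_lt ht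
      have h2 := hdeg t
      omega)
  have htwo : ∀ x y, G.neighborSet v ≠ {x, y} := fun x y h => by
    have hv : ∀ t, G.Adj v t ↔ t = x ∨ t = y := fun t => by
      rw [← mem_neighborSet, h]; simp
    exact hno (exists_extend_of_degree_le_two hc (fun t => (hv t).1)
      (hlist x ((hv x).2 (by simp))) (hlist y ((hv y).2 (by simp))))
  have h3 : (G.neighborSet v).ncard = 3 := by
    have hpos := (Set.ncard_pos (Set.toFinite _)).2 hv0
    have h1 : (G.neighborSet v).ncard ≠ 1 := fun h => by
      obtain ⟨x, hx⟩ := Set.ncard_eq_one.1 h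
      exact htwo x x (by simpa using hx)
    have h2 : (G.neighborSet v).ncard ≠ 2 := fun h => by
      obtain ⟨x, y, -, hxy⟩ := Set.ncard_eq_two.1 h
      exact htwo x y hxy
    omega
  refine ⟨h3, fun t ht => ?_⟩
  by_contra hne
  have hnot : ∀ a, (G.deleteIncidenceSet v).availableColors c t ≠ {a} :=
    availableColors_ne_singleton (by
      have h1 := ncard_neighborSet_deleteIncidenceSet_lt ht
      have h2 := hdeg t
      omega)
  obtain ⟨x, y, z, hxy, hxz, hyz, hN⟩ := Set.ncard_eq_three.1 h3
  have hv : ∀ t, G.Adj v t ↔ t = x ∨ t = y ∨ t = z := fun t => by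
    rw [← mem_neighborSet, hN]; simp
  obtain ⟨c', hc', -⟩ := exists_extend_of_degree_eq_three hc hv hxy hxz hyz
    (hlist x ((hv x).2 (by simp))) (hlist y ((hv y).2 (by simp)))
    (hlist z ((hv z).2 (by simp))) (by
      rintro ⟨a, h1, h2, h3⟩
      rcases (hv t).1 ht with rfl | rfl | rfl
      · exact hnot a h1
      · exact hnot a h2
      · exact hnot a h3)
  exact hno ⟨c', hc'⟩

/-- If every nonisolated vertex of degree at most `3` has degree `3` and only neighbors of degree
`2 * m - 1`, then some two of these vertices have a common neighbor. -/
lemma exists_two_low_neighbors {m : ℕ} (hs : G.IsHereditarilySparse 3) (hG : G ≠ ⊥)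
    (hm : ∀ v, (G.neighborSet v).Nonempty → (G.neighborSet v).ncard ≤ 3 →
      (G.neighborSet v).ncard = 3 ∧ ∀ t, G.Adj v t → (G.neighborSet t).ncard + 1 = 2 * m) :
    ∃ x v w, v ≠ w ∧ G.Adj x v ∧ G.Adj x w ∧ (G.neighborSet v).ncard ≤ 3 ∧
      (G.neighborSet w).ncard ≤ 3 := by
  have key : ∀ x, 1 < {u | G.Adj x u ∧ (G.neighborSet u).ncard ≤ 3}.ncard →
      ∃ x v w, v ≠ w ∧ G.Adj x v ∧ G.Adj x w ∧ (G.neighborSet v).ncard ≤ 3 ∧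
      (G.neighborSet w).ncard ≤ 3 := fun x hx => by
    obtain ⟨v, w, hv, hw, hvw⟩ := (Set.one_lt_ncard_iff (Set.toFinite _)).1 hx
    exact ⟨x, v, w, hvw, hv.1, hw.1, hv.2, hw.2⟩
  by_cases hB : {u | 4 ≤ (G.neighborSet u).ncard}.Nonempty
  · obtain ⟨x, hx, hcard⟩ := hs _ hB
    have hx4 : 4 ≤ (G.neighborSet x).ncard := hx
    have hsplit : (G.neighborSet x).ncard ≤
        {u | u ∈ {u | 4 ≤ (G.neighborSet u).ncard} ∧ G.Adj x u}.ncard +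
        {u | G.Adj x u ∧ (G.neighborSet u).ncard ≤ 3}.ncard := by
      refine (Set.ncard_le_ncard fun u hu => ?_).trans (Set.ncard_union_le _ _)
      by_cases h : 4 ≤ (G.neighborSet u).ncard
      · exact .inl ⟨h, hu⟩
      · exact .inr ⟨hu, by omega⟩
    have hpos : 0 < {u | G.Adj x u ∧ (G.neighborSet u).ncard ≤ 3}.ncard := by omega
    obtain ⟨v, hv, hv3⟩ := (Set.ncard_pos (Set.toFinite _)).1 hpos
    -- the degree of `x` is odd and at least `4`, hence at least `5`
    have := (hm v ⟨x, hv.symm⟩ hv3).2 x hv.symm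
    exact key x (by omega)
  · have hall : ∀ u, (G.neighborSet u).ncard ≤ 3 := fun u => by
      by_contra h
      exact hB ⟨u, by simp only [Set.mem_ofPred_eq]; omega⟩
    obtain ⟨x, y, hxy⟩ := ne_bot_iff_exists_adj.1 hG
    refine key x ?_
    have h3 := (hm x ⟨y, hxy⟩ (hall x)).1
    have : {u | G.Adj x u ∧ (G.neighborSet u).ncard ≤ 3} = G.neighborSet x := by
      ext u; simp [hall]
    rw [this]
    omega

/-- Every graph with maximum degree at most `2k - 1` in which each nonempty set of vertices contains
a vertex with at most three neighbors in the set has a linear coloring with `k` colors. -/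
theorem exists_isLinearColoring [Nonempty K] (hs : G.IsHereditarilySparse 3)
    (hdeg : ∀ t, (G.neighborSet t).ncard < 2 * Fintype.card K) :
    ∃ c : Sym2 V → K, G.IsLinearColoring c := by
  classical
  induction hn : G.edgeSet.ncard using Nat.strong_induction_on generalizing G with
  | _ n ih =>
  subst hn
  by_cases hG : G = ⊥
  · subst hG
    refine ⟨fun _ => Classical.arbitrary K, fun i =>
      IsPathUnion.anti (H := ⊥) (fun _ _ h => h.1) ?_⟩
    exact ⟨isAcyclic_bot, fun v => by simp⟩
  by_contra hno
  have hdel : ∀ v t, G.Adj v t →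
      ∃ c : Sym2 V → K, (G.deleteIncidenceSet v).IsLinearColoring c := fun v t h =>
    ih _ (ncard_edgeSet_deleteIncidenceSet_lt h) (hs.anti (G.deleteIncidenceSet_le v))
      (fun t => (ncard_neighborSet_mono (G.deleteIncidenceSet_le v) t).trans_lt (hdeg t)) rfl
  have hlow : ∀ v, (G.neighborSet v).Nonempty → (G.neighborSet v).ncard ≤ 3 →
      (G.neighborSet v).ncard = 3 ∧
      ∀ t, G.Adj v t → (G.neighborSet t).ncard + 1 = 2 * Fintype.card K := by
    rintro v ⟨t, ht⟩ hv3
    obtain ⟨c, hc⟩ := hdel v t ht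
    exact neighbors_of_not_exists_extend hdeg hc hno ⟨t, ht⟩ hv3
  obtain ⟨x, v, w, hvw, hxv, hxw, hv3, hw3⟩ := exists_two_low_neighbors hs hG hlow
  have hv3' := (hlow v ⟨x, hxv.symm⟩ hv3).1
  obtain ⟨y, z, hyz, hN⟩ : ∃ y z, y ≠ z ∧ G.neighborSet v \ {x} = {y, z} := by
    refine Set.ncard_eq_two.1 ?_
    rw [Set.ncard_sdiff_singleton_of_mem (show x ∈ G.neighborSet v from hxv.symm), hv3']
  have hxy : x ≠ y := by
    have : y ∈ G.neighborSet v \ {x} := by simp [hN]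
    exact Ne.symm this.2
  have hxz : x ≠ z := by
    have : z ∈ G.neighborSet v \ {x} := by simp [hN]
    exact Ne.symm this.2
  have hv : ∀ t, G.Adj v t ↔ t = x ∨ t = y ∨ t = z := fun t => by
    have h : t ∈ G.neighborSet v \ {x} ↔ t ∈ ({y, z} : Set V) := by rw [hN]
    simp only [Set.mem_sdiff, mem_neighborSet, Set.mem_singleton_iff, Set.mem_insert_iff] at h
    by_cases htx : t = x
    · subst htx; simp [hxv.symm]
    · simpa [htx] using h
  have hvy : G.Adj v y := (hv y).2 (by simp)
  have hvz : G.Adj v z := (hv z).2 (by simp)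
  obtain ⟨c₁, hc₁⟩ := hdel v x hxv.symm
  obtain ⟨hvw', p, q, hw, hxp, hxq, hpq, hpy, hpz, hqy, hqz⟩ :=
    (exists_extend_or_neighbors hdeg hc₁ hv hxy hxz hyz hxw hvw hw3).resolve_left hno
  have hwp : G.Adj w p := (hw p).2 (by simp)
  have hpv : p ≠ v := fun h => hvw' (h ▸ hwp.symm)
  -- remove `w` and move the edge `vx` to `vp`: the color classes at `v` then keep `y`, `z`, `p`
  -- from missing the same color only
  set M := (G.deleteIncidenceSet w).deleteEdges {s(v, x)} with hM
  have hMG : M ≤ G := (deleteEdges_le _).trans (G.deleteIncidenceSet_le w)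
  set G₂ := M ⊔ edge v p with hG₂
  have hMadj : ∀ a b, M.Adj a b ↔ (G.Adj a b ∧ a ≠ w ∧ b ≠ w) ∧ s(a, b) ≠ s(v, x) := fun a b => by
    rw [hM, deleteEdges_adj, deleteIncidenceSet_adj]; simp
  have hG₂adj : ∀ a b, G₂.Adj a b ↔
      M.Adj a b ∨ ((a = v ∧ b = p ∨ a = p ∧ b = v) ∧ a ≠ b) := fun a b => by
    rw [hG₂, sup_adj, edge_adj]
  have hcardE : G₂.edgeSet.ncard < G.edgeSet.ncard := by
    have h1 := ncard_edgeSet_deleteIncidenceSet_lt ((hw x).2 (by simp))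
    have h2 : M.edgeSet.ncard < (G.deleteIncidenceSet w).edgeSet.ncard := by
      refine Set.ncard_lt_ncard ⟨edgeSet_mono (deleteEdges_le _), fun hsub => ?_⟩
      have hmem : s(v, x) ∈ (G.deleteIncidenceSet w).edgeSet :=
        deleteIncidenceSet_adj.2 ⟨hxv.symm, hvw, hxw.ne⟩
      exact ((hMadj v x).1 (hsub hmem)).2 rfl
    have h3 : G₂.edgeSet ⊆ insert s(v, p) M.edgeSet := by
      intro e
      induction e with | _ a b =>
      intro h
      rcases (hG₂adj a b).1 h with h | ⟨h, -⟩
      · exact .inr h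
      · exact .inl (Sym2.eq_iff.2 h)
    have h4 := (Set.ncard_le_ncard h3).trans (Set.ncard_insert_le _ _)
    omega
  have hNv : G₂.neighborSet v ⊆ {y, z, p} := by
    intro t ht
    rcases (hG₂adj v t).1 ht with h | ⟨h, -⟩
    · have h' := (hMadj v t).1 h
      rcases (hv t).1 h'.1.1 with rfl | rfl | rfl
      · exact (h'.2 rfl).elim
      · simp
      · simp
    · rcases h with ⟨-, rfl⟩ | ⟨h, -⟩
      · simp
      · exact (hpv h.symm).elim
  have hNv3 : (G₂.neighborSet v).ncard ≤ 3 :=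
    (Set.ncard_le_ncard hNv).trans (Set.ncard_eq_three.2 ⟨y, z, p, hyz, hpy.symm, hpz.symm, rfl⟩).le
  have hdeg₂ : ∀ t, (G₂.neighborSet t).ncard < 2 * Fintype.card K := by
    intro t
    refine lt_of_le_of_lt ?_ (hdeg t)
    by_cases htv : t = v
    · subst htv; rwa [hv3']
    by_cases htp : t = p
    · subst htp
      have h1 := ncard_neighborSet_deleteIncidenceSet_lt hwp
      have h2 : G₂.neighborSet t ⊆ insert v ((G.deleteIncidenceSet w).neighborSet t) := by
        intro b hb
        rcases (hG₂adj t b).1 hb with h | ⟨h, -⟩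
        · exact .inr (deleteEdges_le _ h)
        · left
          grind
      have h3 := (Set.ncard_le_ncard h2).trans (Set.ncard_insert_le _ _)
      omega
    · refine Set.ncard_le_ncard fun b hb => ?_
      rcases (hG₂adj t b).1 hb with h | ⟨h, -⟩
      · exact hMG h
      · grind
  have hs₂ : G₂.IsHereditarilySparse 3 := by
    intro S hS
    by_cases hvS : v ∈ S
    · exact ⟨v, hvS, (Set.ncard_le_ncard (t := G₂.neighborSet v) fun u hu => hu.2).trans hNv3⟩
    · obtain ⟨a, ha, hcard⟩ := hs S hS
      refine ⟨a, ha, (Set.ncard_le_ncard (s := {u | u ∈ S ∧ G₂.Adj a u}) fun b hb => ?_).trans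
        hcard⟩
      refine ⟨hb.1, ?_⟩
      rcases (hG₂adj a b).1 hb.2 with h | ⟨⟨rfl, -⟩ | ⟨-, rfl⟩, -⟩
      · exact hMG h
      · exact (hvS ha).elim
      · exact (hvS hb.1).elim
  obtain ⟨c₂, hc₂⟩ := ih _ hcardE hs₂ hdeg₂ rfl
  have hle : ∀ a b, ((G.deleteIncidenceSet v).deleteIncidenceSet w).Adj a b →
      G₂.Adj a b ∧ a ≠ v ∧ b ≠ v := by
    intro a b h
    rw [deleteIncidenceSet_adj, deleteIncidenceSet_adj] at h
    refine ⟨(hG₂adj a b).2 (.inl ((hMadj a b).2 ⟨⟨h.1.1, h.2⟩, fun he => ?_⟩)), h.1.2⟩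
    rcases Sym2.eq_iff.1 he with ⟨h1, -⟩ | ⟨-, h1⟩
    · exact h.1.2.1 h1
    · exact h.1.2.2 h1
  have hMv : ∀ t, G.Adj v t → t ≠ x → G₂.Adj v t := fun t ht htx =>
    (hG₂adj v t).2 (.inl ((hMadj v t).2 ⟨⟨ht, hvw, fun h => hvw' (h ▸ ht)⟩,
      fun he => htx (Sym2.congr_right.1 he)⟩))
  exact hno (exists_extend_two_vertices hdeg (hc₂.anti fun a b h => (hle a b h).1) hv hxy hxz hyz
    hw hxp hxq hpq hvw' hpy hpz hqy hqz
    (not_availableColors_eq_singleton hc₂ hle (hMv y hvy hxy.symm) (hMv z hvz hxz.symm)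
      ((hG₂adj v p).2 (.inr ⟨.inl ⟨rfl, rfl⟩, hpv.symm⟩)) hyz hpy.symm hpz.symm))

end Main

/-! ### Degeneracy, treewidth and linear arboricity -/

section Sparse

lemma dist_lt_of_mem_support_geodesic {N : Type*} {T : SimpleGraph N} {s r a : N} {q : T.Walk s r}
    (hq : q.length = T.dist s r) (ha : a ∈ q.support) (has : a ≠ s) :
    T.dist a r < T.dist s r := by
  classical
  have h1 := congrArg Walk.length (q.take_spec ha)
  rw [Walk.length_append] at h1
  have h2 := dist_le (q.dropUntil a ha)
  have h3 : (q.takeUntil a ha).length ≠ 0 := fun h => has (Walk.eq_of_length_eq_zero h).symm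
  omega

/-- In a connected graph, let `s` be a vertex of a connected set `X` that is closest to `r`. Any
`t ∈ X` is joined to `r` by a path that leads to `s` within `X` and then from `s` to `r`. -/
lemma exists_isPath_append_of_closest {N : Type*} {T : SimpleGraph N} (hT : T.Connected)
    {X : Set N} (hX : (T.induce X).Preconnected) {r s t : N} (hs : s ∈ X) (ht : t ∈ X)
    (hmin : ∀ a ∈ X, T.dist s r ≤ T.dist a r) :
    ∃ (p : T.Walk t s) (q : T.Walk s r), (p.append q).IsPath ∧ q.length = T.dist s r ∧
      ∀ a ∈ p.support, a ∈ X := by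
  obtain ⟨p₀, hp₀⟩ := (hX ⟨t, ht⟩ ⟨s, hs⟩).exists_isPath
  obtain ⟨q, hq, hql⟩ := hT.exists_path_of_dist s r
  obtain ⟨p, hp, hpX⟩ : ∃ p : T.Walk t s, p.IsPath ∧ ∀ a ∈ p.support, a ∈ X := by
    have hmem : ∀ a ∈ (p₀.map (Embedding.induce X).toHom).support, a ∈ X := by
      intro a ha
      rw [Walk.support_map, List.mem_map] at ha
      obtain ⟨b, -, rfl⟩ := ha
      exact b.2
    exact ⟨p₀.map (Embedding.induce X).toHom,
      (Walk.isPath_map_iff_of_injective Subtype.val_injective).2 hp₀, hmem⟩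
  refine ⟨p, q, Walk.IsPath.mk' ?_, hql, hpX⟩
  rw [Walk.support_append]
  have hqn := hq.support_nodup
  rw [← Walk.cons_tail_support, List.nodup_cons] at hqn
  refine List.nodup_append.2 ⟨hp.support_nodup, hqn.2, fun a ha b hb hab => ?_⟩
  subst hab
  have hne : a ≠ s := fun h => hqn.1 (h ▸ hb)
  exact absurd (dist_lt_of_mem_support_geodesic hql (List.mem_of_mem_tail hb) hne)
    (not_lt.2 (hmin a (hpX a ha)))

variable {V : Type*} {G : SimpleGraph V}

/-- Root the tree. Among the vertices in the given set choose one, `v`, whose topmost bag is as far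
as possible from the root; then this bag contains all neighbors of `v` in the set. -/
theorem TreeDecomposition.isHereditarilySparse [Finite V] (D : G.TreeDecomposition) :
    G.IsHereditarilySparse D.width := by
  classical
  let := D.fintypeNode
  obtain ⟨r⟩ := D.isTree.1.nonempty
  have htop : ∀ v, ∃ s, v ∈ D.bag s ∧ ∀ a, v ∈ D.bag a → D.tree.dist s r ≤ D.tree.dist a r :=
    fun v => Set.exists_min_image {s | v ∈ D.bag s} (fun s => D.tree.dist s r) (Set.toFinite _)
      (D.exists_mem_bag v)
  choose top htop hmin using htop
  intro S hS
  obtain ⟨v, hv, hmax⟩ := Set.exists_max_image S (fun v => D.tree.dist (top v) r)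
    (Set.toFinite _) hS
  refine ⟨v, hv, ?_⟩
  have hsub : {u | u ∈ S ∧ G.Adj v u} ⊆ ((D.bag (top v)).erase v : Finset V) := by
    rintro u ⟨hu, huv⟩
    rw [Finset.mem_coe, Finset.mem_erase]
    refine ⟨huv.ne', ?_⟩
    obtain ⟨t, htv, htu⟩ := D.exists_adj_mem_bag v u huv
    obtain ⟨p, q, hpq, hq, hp⟩ := exists_isPath_append_of_closest D.isTree.1 (D.preconnected v)
      (htop v) htv (hmin v)
    obtain ⟨p', q', hpq', hq', hp'⟩ := exists_isPath_append_of_closest D.isTree.1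
      (D.preconnected u) (htop u) htu (hmin u)
    -- both topmost nodes lie on the path from `t` to the root
    have heq : p.append q = p'.append q' :=
      (D.isTree.existsUnique_path t r).unique hpq hpq'
    have hmem : top v ∈ (p'.append q').support := by
      rw [← heq, Walk.mem_support_append_iff]
      exact .inl p.end_mem_support
    rcases Walk.mem_support_append_iff _ _ |>.1 hmem with h | h
    · exact hp' _ h
    · by_cases hne : top v = top u
      · rw [hne]; exact htop u
      · exact absurd (dist_lt_of_mem_support_geodesic hq' h hne) (not_lt.2 (hmax u hu))
  have h1 := Set.ncard_le_ncard hsub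
  rw [Set.ncard_coe_finset, Finset.card_erase_of_mem (htop v)] at h1
  have h2 : (D.bag (top v)).card ≤ Finset.univ.sup (fun t => (D.bag t).card) :=
    Finset.le_sup (f := fun t => (D.bag t).card) (Finset.mem_univ _)
  have h3 : D.width = Finset.univ.sup (fun t => (D.bag t).card) - 1 := rfl
  omega

lemma IsHereditarilySparse.mono {s t : ℕ} (hst : s ≤ t) (h : G.IsHereditarilySparse s) :
    G.IsHereditarilySparse t := fun S hS => by
  obtain ⟨v, hv, hcard⟩ := h S hS
  exact ⟨v, hv, hcard.trans hst⟩

lemma isHereditarilySparse_of_treewidth_le [Finite V] {t : ℕ} (h : G.treewidth ≤ t) :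
    G.IsHereditarilySparse t := by
  obtain ⟨D, hD⟩ : ∃ D : G.TreeDecomposition, D.width ≤ t := by
    by_contra! hlt
    have h1 : ((t + 1 : ℕ) : ℕ∞) ≤ G.treewidth := le_iInf fun D => by exact_mod_cast hlt D
    have h2 := h1.trans h
    have : t + 1 ≤ t := by exact_mod_cast h2
    omega
  exact D.isHereditarilySparse.mono hD

/-- In a nonempty set of vertices, the one that comes first has few neighbors in the set. -/
lemma IsDegenerate.isHereditarilySparse [Fintype V] {t : ℕ} (h : G.IsDegenerate t) :
    G.IsHereditarilySparse t := by
  obtain ⟨e, he⟩ := h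
  intro S hS
  obtain ⟨i, hi, hmin⟩ := Set.exists_min_image (e ⁻¹' S) id (Set.toFinite _)
    (hS.preimage e.surjective)
  refine ⟨e i, hi, (Set.ncard_le_ncard (t := e '' {j | i < j ∧ G.Adj (e i) (e j)}) ?_).trans
    ((Set.ncard_image_le (Set.toFinite _)).trans (he i))⟩
  rintro u ⟨hu, hadj⟩
  obtain ⟨j, rfl⟩ := e.surjective u
  refine ⟨j, ⟨lt_of_le_of_ne (hmin j hu) ?_, hadj⟩, rfl⟩
  rintro rfl
  exact hadj.ne rfl

end Sparse

section LinearArboricity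

variable {V : Type*} {G : SimpleGraph V}

lemma IsLinearColoring.exists_isLinear [Finite V] {K : Type*} {c : Sym2 V → K}
    (hc : G.IsLinearColoring c) : ∃ c' : G.EdgeLabeling K, c'.IsLinear := by
  let c' : G.EdgeLabeling K := fun e => c e
  refine ⟨c', fun i => ?_⟩
  have : c'.labelGraph i = G.colorClass c i := by
    ext a b
    rw [EdgeLabeling.labelGraph_adj, colorClass_adj]
    exact ⟨fun ⟨h, hi⟩ => ⟨h, hi⟩, fun ⟨h, hi⟩ => ⟨h, hi⟩⟩
  rw [this]
  exact (hc i).isLinearForest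

lemma linearArboricity_le {k : ℕ} (h : ∃ c : G.EdgeLabeling (Fin k), c.IsLinear) :
    G.linearArboricity ≤ k :=
  iInf₂_le k h

lemma IsHereditarilySparse.exists_isLinear [Fintype V] [DecidableRel G.Adj]
    (hs : G.IsHereditarilySparse 3) {k : ℕ} (hk : 0 < k) (hdeg : G.maxDegree ≤ 2 * k - 1) :
    ∃ c : G.EdgeLabeling (Fin k), c.IsLinear := by
  have : Nonempty (Fin k) := ⟨⟨0, hk⟩⟩
  obtain ⟨c, hc⟩ := exists_isLinearColoring (K := Fin k) hs fun t => by
    have h1 := G.degree_le_maxDegree t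
    rw [Set.ncard_eq_toFinset_card', Set.toFinset_card, card_neighborSet_eq_degree,
      Fintype.card_fin]
    omega
  exact hc.exists_isLinear

lemma IsHereditarilySparse.linearArboricity_le_ceil [Fintype V] [DecidableRel G.Adj]
    (hs : G.IsHereditarilySparse 3) :
    G.linearArboricity ≤ (⌈((G.maxDegree : ℚ) + 1) / 2⌉₊ : ℕ) := by
  have h1 := Nat.le_ceil (((G.maxDegree : ℚ) + 1) / 2)
  have h2 : G.maxDegree + 1 ≤ 2 * ⌈((G.maxDegree : ℚ) + 1) / 2⌉₊ := by
    have : ((G.maxDegree : ℚ) + 1) ≤ 2 * (⌈((G.maxDegree : ℚ) + 1) / 2⌉₊ : ℚ) := by linarith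
    exact_mod_cast this
  exact linearArboricity_le (hs.exists_isLinear (by omega) (by omega))

end LinearArboricity

end SimpleGraph

theorem mainTheorem1 {V : Type*} [Fintype V] (G : SimpleGraph V) [DecidableRel G.Adj] :
    (G.IsDegenerate 3 → ∀ k : ℕ, 0 < k → G.maxDegree ≤ 2 * k - 1 →
      (∃ c : G.EdgeLabeling (Fin k), c.IsLinear) ∧ G.linearArboricity ≤ k) ∧
    (G.IsDegenerate 3 →
      G.linearArboricity ≤ (⌈((G.maxDegree : ℚ) + 1) / 2⌉₊ : ℕ)) ∧
    (G.treewidth ≤ 3 →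
      G.linearArboricity ≤ (⌈((G.maxDegree : ℚ) + 1) / 2⌉₊ : ℕ)) := by
  refine ⟨fun h k hk hdeg => ?_, fun h => h.isHereditarilySparse.linearArboricity_le_ceil,
    fun h => (SimpleGraph.isHereditarilySparse_of_treewidth_le h).linearArboricity_le_ceil⟩
  have hc := h.isHereditarilySparse.exists_isLinear hk hdeg
  exact ⟨hc, SimpleGraph.linearArboricity_le hc⟩
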